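/- For a graph $G$ on $n$ vertices and integers $1\le k\le n$, $\ell\ge 0$, let $A$ be a uniformly random $k$-element subset of $V(G)$ and let $X_{G,k}=e(G[A])$ be the number of edges of $G$ with both endpoints in $A$. Put $I(n,k,\ell)=\max\{\Pr(X_{G,k}=\ell) : |V(G)|=n\}$ and let $\mathrm{ind}(k,\ell)=\lim_{n\to\infty} I(n,k,\ell)$ be the edge-inducibility (the limit exists because $I(n,k,\ell)$ is non-increasing in $n\ge k$). For a graph $H$ on $k$ vertices, let $D_H(G)$ be the number of induced subgraphs of $G$ isomorphic to $H$ and let $\mathrm{ind}(H)=\lim_{n\to\infty}\max\{D_H(G)/\binom{n}{k} : |V(G)|=n\}$ be the inducibility of $H$ (the limit again exists by monotonicity). Then for every fixed integer $\ell\ge 1$, $$\mathrm{ind}(k,\ell)\le \tfrac34+o_k(1),$$ that is, for every $\varepsilon>0$ there is $k_0=k_0(\ell,\varepsilon)$ such that $\mathrm{ind}(k,\ell)\le \frac34+\varepsilon$ for all $k\ge k_0$. Moreover, $$\mathrm{ind}(k,1)\le \tfrac12+o_k(1),$$ that is, for every $\varepsilon>0$ there is $k_0=k_0(\varepsilon)$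 such that $\mathrm{ind}(k,1)\le\frac12+\varepsilon$ for all $k\ge k_0$. In particular, the $k$-vertex graph $H$ with exactly one edge satisfies $\mathrm{ind}(H)\le \frac12+o_k(1)$ as $k\to\infty$. -/

import Mathlib

open Filter Topology

noncomputable section

namespace EdgeStat

/-- The number of edges of a graph (as a natural number; all graphs below are finite). -/
def numEdges {V : Type} (G : SimpleGraph V) : ℕ := G.edgeSet.ncard

/-- The number of `k`-element vertex sets `A` of `G` whose induced subgraph `G[A]` has exactly
`ℓ` edges. -/
def edgeCount {n : ℕ} (G : SimpleGraph (Fin n)) (k ℓ : ℕ) : ℕ :=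
  ((Finset.powersetCard k (Finset.univ : Finset (Fin n))).filter
    (fun A : Finset (Fin n) => numEdges (G.induce (A : Set (Fin n))) = ℓ)).card

/-- The probability that a uniformly random `k`-element vertex set of `G` induces exactly
`ℓ` edges. -/
def edgeDensity {n : ℕ} (G : SimpleGraph (Fin n)) (k ℓ : ℕ) : ℝ :=
  (edgeCount G k ℓ : ℝ) / (n.choose k : ℝ)

/-- `I(n, k, ℓ)`: the maximum of `edgeDensity G k ℓ` over all graphs `G` of order `n`
(a supremum over a finite non-empty family). -/
def maxEdgeDensity (n k ℓ : ℕ) : ℝ := ⨆ G : SimpleGraph (Fin n), edgeDensity G k ℓ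

/-- The edge-inducibility `ind(k, ℓ)`, the limit of `I(n, k, ℓ)` as `n → ∞`
(it exists: `tendsto_maxEdgeDensity`). -/
def edgeInducibility (k ℓ : ℕ) : ℝ := limUnder atTop (fun n : ℕ => maxEdgeDensity n k ℓ)

open Classical in
/-- `D_H(G)`: the number of induced subgraphs of `G` isomorphic to `H`. -/
def copyCount {n k : ℕ} (H : SimpleGraph (Fin k)) (G : SimpleGraph (Fin n)) : ℕ :=
  ((Finset.powersetCard k (Finset.univ : Finset (Fin n))).filter
    (fun A : Finset (Fin n) => Nonempty (G.induce (A : Set (Fin n)) ≃g H))).card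

/-- The maximum over graphs `G` of order `n` of the density of induced copies of `H` in `G`. -/
def maxCopyDensity {k : ℕ} (n : ℕ) (H : SimpleGraph (Fin k)) : ℝ :=
  ⨆ G : SimpleGraph (Fin n), (copyCount H G : ℝ) / (n.choose k : ℝ)

/-- The inducibility `ind(H)` of a graph `H`, the limit of the maximum density of induced copies
of `H` in graphs of order `n` as `n → ∞` (it exists: `tendsto_maxCopyDensity`). -/
def graphInducibility {k : ℕ} (H : SimpleGraph (Fin k)) : ℝ :=
  limUnder atTop (fun n : ℕ => maxCopyDensity n H)

/-! The two limits exist, by the standard averaging argument. -/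

/-- Induced subgraphs of a pullback along an embedding are induced subgraphs. -/
def inducePullbackIso {V W : Type} (f : V ↪ W) (G : SimpleGraph W) (S : Finset V) :
    (G.comap f).induce (S : Set V) ≃g G.induce ((S.map f : Finset W) : Set W) where
  toEquiv := Equiv.ofBijective
    (fun x : (S : Set V) => (⟨f x.1, by simp⟩ : ((S.map f : Finset W) : Set W)))
    ⟨fun x y h => Subtype.ext (f.injective (congrArg Subtype.val h)), by
      rintro ⟨y, hy⟩
      obtain ⟨x, hx, rfl⟩ := Finset.mem_map.1 (Finset.mem_coe.1 hy)
      exact ⟨⟨x, hx⟩, rfl⟩⟩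
  map_rel_iff' := by
    intro a b
    simp

theorem numEdges_congr {V W : Type} {G : SimpleGraph V} {H : SimpleGraph W} (e : G ≃g H) :
    numEdges G = numEdges H :=
  Nat.card_congr e.mapEdgeSet

open Classical in
/-- Averaging over the vertex-deleted subgraphs, for an isomorphism-invariant property. -/
theorem sum_count_delete {P : ∀ V : Type, SimpleGraph V → Prop}
    (hP : ∀ (V W : Type) (G : SimpleGraph V) (H : SimpleGraph W), (G ≃g H) → (P V G ↔ P W H))
    {n k : ℕ} (G : SimpleGraph (Fin (n + 1))) :
    ∑ v : Fin (n + 1), ((Finset.powersetCard k (Finset.univ : Finset (Fin n))).filter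
      (fun A : Finset (Fin n) => P _ ((G.comap v.succAboveEmb).induce (A : Set (Fin n))))).card =
    (n + 1 - k) * ((Finset.powersetCard k (Finset.univ : Finset (Fin (n + 1)))).filter
      (fun A : Finset (Fin (n + 1)) => P _ (G.induce (A : Set (Fin (n + 1)))))).card := by
  set F := (Finset.powersetCard k (Finset.univ : Finset (Fin (n + 1)))).filter
      (fun A : Finset (Fin (n + 1)) => P _ (G.induce (A : Set (Fin (n + 1))))) with hF
  have h1 : ∀ v : Fin (n + 1),
      ((Finset.powersetCard k (Finset.univ : Finset (Fin n))).filter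
        (fun A : Finset (Fin n) => P _ ((G.comap v.succAboveEmb).induce (A : Set (Fin n))))).card =
      (F.filter (fun A => v ∉ A)).card := by
    intro v
    refine Finset.card_bij (fun A _ => A.map v.succAboveEmb) ?_ ?_ ?_
    · intro A hA
      simp only [Finset.mem_filter, Finset.mem_powersetCard, Finset.subset_univ, true_and] at hA
      simp only [hF, Finset.mem_filter, Finset.mem_powersetCard, Finset.subset_univ, true_and,
        Finset.card_map]
      refine ⟨⟨hA.1, (hP _ _ _ _ (inducePullbackIso v.succAboveEmb G A)).1 hA.2⟩, ?_⟩
      simp [Fin.succAbove_ne]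
    · intro A _ B _ h
      exact Finset.map_injective _ h
    · intro B hB
      simp only [hF, Finset.mem_filter, Finset.mem_powersetCard, Finset.subset_univ,
        true_and] at hB
      obtain ⟨⟨hB1, hB2⟩, hB3⟩ := hB
      have hsub : ∃ A : Finset (Fin n), A.map v.succAboveEmb = B := by
        refine ⟨Finset.univ.filter (fun x => v.succAbove x ∈ B), ?_⟩
        ext y
        simp only [Finset.mem_map, Finset.mem_filter, Finset.mem_univ, true_and,
          Fin.coe_succAboveEmb]
        constructor
        · rintro ⟨x, hx, rfl⟩
          exact hx
        · intro hy
          have hne : y ≠ v := fun h => hB3 (h ▸ hy)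
          obtain ⟨x, rfl⟩ := Fin.exists_succAbove_eq hne
          exact ⟨x, hy, rfl⟩
      obtain ⟨A, rfl⟩ := hsub
      refine ⟨A, ?_, rfl⟩
      simp only [Finset.mem_filter, Finset.mem_powersetCard, Finset.subset_univ, true_and]
      rw [Finset.card_map] at hB1
      exact ⟨hB1, (hP _ _ _ _ (inducePullbackIso v.succAboveEmb G A)).2 hB2⟩
  simp_rw [h1, Finset.card_filter (fun A => _ ∉ A) F]
  rw [Finset.sum_comm]
  simp_rw [← Finset.card_filter]
  rw [Finset.sum_const_nat (m := n + 1 - k), mul_comm]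
  intro A hA
  have hc : A.card = k := (Finset.mem_powersetCard.1 (Finset.mem_filter.1 hA).1).2
  have : (Finset.univ.filter (fun v => v ∉ A)) = Aᶜ := by
    ext; simp
  rw [this, Finset.card_compl, hc, Fintype.card_fin]

open Classical in
/-- The maximum density of an isomorphism-invariant property of induced `k`-vertex subgraphs
converges as the order of the host graph tends to infinity. -/
theorem exists_tendsto_max {P : ∀ V : Type, SimpleGraph V → Prop}
    (hP : ∀ (V W : Type) (G : SimpleGraph V) (H : SimpleGraph W), (G ≃g H) → (P V G ↔ P W H))
    (k : ℕ) :
    ∃ a : ℝ, Tendsto (fun n : ℕ => ⨆ G : SimpleGraph (Fin n),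
      (((Finset.powersetCard k (Finset.univ : Finset (Fin n))).filter
        (fun A : Finset (Fin n) => P _ (G.induce (A : Set (Fin n))))).card : ℝ) / (n.choose k : ℝ))
      atTop (𝓝 a) := by
  set c : ∀ n : ℕ, SimpleGraph (Fin n) → ℕ := fun n G =>
    ((Finset.powersetCard k (Finset.univ : Finset (Fin n))).filter
        (fun A : Finset (Fin n) => P _ (G.induce (A : Set (Fin n))))).card with hc
  set M : ℕ → ℝ := fun n => ⨆ G : SimpleGraph (Fin n), (c n G : ℝ) / (n.choose k : ℝ) with hM
  change ∃ a : ℝ, Tendsto M atTop (𝓝 a)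
  have hle : ∀ n (G : SimpleGraph (Fin n)), (c n G : ℝ) / (n.choose k : ℝ) ≤ M n := fun n G =>
    le_ciSup (f := fun G : SimpleGraph (Fin n) => (c n G : ℝ) / (n.choose k : ℝ))
      (Set.finite_range _).bddAbove G
  have hnn : ∀ n, 0 ≤ M n := fun n => Real.iSup_nonneg fun G => by positivity
  have hstep : ∀ n, k ≤ n → M (n + 1) ≤ M n := by
    intro n hn
    refine ciSup_le fun G => ?_
    have hs := sum_count_delete hP (k := k) G
    have hs' : ∑ v : Fin (n + 1), (c n (G.comap v.succAboveEmb) : ℝ) =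
        ((n + 1 - k : ℕ) : ℝ) * (c (n + 1) G : ℝ) := by
      exact_mod_cast hs
    have hpos : (0 : ℝ) < (n.choose k : ℝ) := by exact_mod_cast Nat.choose_pos hn
    have hpos' : (0 : ℝ) < ((n + 1).choose k : ℝ) := by
      exact_mod_cast Nat.choose_pos (by omega)
    have hd : (0 : ℝ) < ((n + 1 - k : ℕ) : ℝ) := by
      exact_mod_cast (by omega : 0 < n + 1 - k)
    have hb : ∑ v : Fin (n + 1), (c n (G.comap v.succAboveEmb) : ℝ) ≤
        ((n : ℝ) + 1) * (M n * (n.choose k : ℝ)) := by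
      calc _ ≤ ∑ v : Fin (n + 1), M n * (n.choose k : ℝ) :=
            Finset.sum_le_sum fun v _ => (div_le_iff₀ hpos).1 (hle n _)
        _ = _ := by simp
    have hch : ((n + 1).choose k : ℝ) * ((n + 1 - k : ℕ) : ℝ) =
        (n.choose k : ℝ) * ((n : ℝ) + 1) := by
      exact_mod_cast (Nat.choose_mul_succ_eq n k).symm
    rw [div_le_iff₀ hpos']
    refine le_of_mul_le_mul_left ?_ hd
    calc ((n + 1 - k : ℕ) : ℝ) * (c (n + 1) G : ℝ)
        ≤ ((n : ℝ) + 1) * (M n * (n.choose k : ℝ)) := hs' ▸ hb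
      _ = M n * ((n.choose k : ℝ) * ((n : ℝ) + 1)) := by ring
      _ = _ := by rw [← hch]; ring
  have hanti : Antitone (fun n => M (n + k)) := by
    refine antitone_nat_of_succ_le fun n => ?_
    have := hstep (n + k) (by omega)
    rwa [show n + 1 + k = n + k + 1 by omega]
  refine ⟨_, (tendsto_add_atTop_iff_nat k).1 (tendsto_atTop_ciInf hanti ⟨0, ?_⟩)⟩
  rintro _ ⟨n, rfl⟩
  exact hnn _

/-- `ind(k, ℓ)` is the limit of `I(n, k, ℓ)`. -/
theorem tendsto_maxEdgeDensity (k ℓ : ℕ) :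
    Tendsto (fun n : ℕ => maxEdgeDensity n k ℓ) atTop (𝓝 (edgeInducibility k ℓ)) := by
  refine tendsto_nhds_limUnder ?_
  obtain ⟨a, ha⟩ := exists_tendsto_max (P := fun _ G => numEdges G = ℓ)
    (fun _ _ _ _ e => by rw [numEdges_congr e]) k
  refine ⟨a, ha.congr fun n => ?_⟩
  unfold maxEdgeDensity edgeDensity edgeCount
  congr!

/-- `ind(H)` is the limit of the maximum densities of induced copies of `H`. -/
theorem tendsto_maxCopyDensity {k : ℕ} (H : SimpleGraph (Fin k)) :
    Tendsto (fun n : ℕ => maxCopyDensity n H) atTop (𝓝 (graphInducibility H)) :=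
  tendsto_nhds_limUnder (exists_tendsto_max (P := fun _ G => Nonempty (G ≃g H))
    (fun _ _ _ _ e => ⟨fun ⟨f⟩ => ⟨e.symm.trans f⟩, fun ⟨f⟩ => ⟨e.trans f⟩⟩) k)

end EdgeStat

end

/-! By monotonicity in `n` it suffices to bound the probability on `2 * k` vertices, where `A` is a
random half. The trace of `A` on a vertex set `W` of bounded size is then nearly uniform among the
subsets of `W` (`card_inter_mem_mul_pow_le`). So it is enough to find a bounded `W` on which the
event `e(A) = ℓ` forces the trace into a proportion of about `c` of all subsets
(`exists_restricted_trace`).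

There are three cases. On a large star, traces with at most `ℓ` edges mostly avoid the centre,
giving about `1/2`. On a large matching, such traces are rare. Otherwise degrees are bounded and
there is a bounded vertex cover; the cover and its neighbourhood form a bounded `W` containing every
edge, so the trace itself induces exactly `ℓ` edges. This last case reduces to a question about all
subsets of a fixed set, answered with `c = 3/4` for `ℓ ≥ 1` and `c = 1/2` for `ℓ = 1` by grouping
subsets according to their trace outside one edge. -/

namespace EdgeStat

/-! ### Counting induced edges -/

section InducedEdges

variable {V : Type} {G : SimpleGraph V}

open Classical in
/-- The number of edges of `G` with both endpoints in the finite set `S`. -/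
noncomputable def inducedEdges (G : SimpleGraph V) (S : Finset V) : ℕ :=
  (S.sym2.filter (· ∈ G.edgeSet)).card

open Classical in
theorem inducedEdges_mono {S T : Finset V} (h : S ⊆ T) : inducedEdges G S ≤ inducedEdges G T :=
  Finset.card_le_card (Finset.filter_subset_filter _ (Finset.sym2_mono h))

theorem numEdges_induce (G : SimpleGraph V) (S : Finset V) :
    numEdges (G.induce (S : Set V)) = inducedEdges G S := by
  unfold numEdges inducedEdges
  rw [← Set.ncard_image_of_injective _ (Sym2.map.injective Subtype.val_injective),
    ← Set.ncard_coe_finset]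
  congr 1
  ext e
  induction e with | _ u v
  simp only [Set.mem_image, Finset.coe_filter, Finset.mk_mem_sym2_iff, SimpleGraph.mem_edgeSet,
    Set.mem_ofPred_eq]
  constructor
  · rintro ⟨e, he, h⟩
    induction e with | _ x y
    rw [SimpleGraph.mem_edgeSet, SimpleGraph.comap_adj] at he
    rw [Sym2.map_mk] at h
    obtain ⟨h1, h2⟩ | ⟨h1, h2⟩ := Sym2.eq_iff.1 h
    · subst h1 h2
      exact ⟨⟨x.2, y.2⟩, he⟩
    · subst h1 h2
      exact ⟨⟨y.2, x.2⟩, he.symm⟩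
  · rintro ⟨⟨hu, hv⟩, h⟩
    exact ⟨s(⟨u, hu⟩, ⟨v, hv⟩), h, rfl⟩

/-- Markov's inequality for `2 ^ (-e(S))`. -/
theorem card_inducedEdges_le_le (G : SimpleGraph V) (ℓ : ℕ) (U : Finset V) :
    ((U.powerset.filter (inducedEdges G · ≤ ℓ)).card : ℝ) ≤
      2 ^ ℓ * ∑ S ∈ U.powerset, (1 / 2 : ℝ) ^ inducedEdges G S := by
  rw [Finset.card_filter, Nat.cast_sum, Finset.mul_sum]
  refine Finset.sum_le_sum fun S _ => ?_
  split_ifs with h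
  · have : (1 / 2 : ℝ) ^ ℓ ≤ (1 / 2 : ℝ) ^ inducedEdges G S :=
      pow_le_pow_of_le_one (by norm_num) (by norm_num) h
    calc ((1 : ℕ) : ℝ) = 2 ^ ℓ * (1 / 2) ^ ℓ := by rw [← mul_pow]; norm_num
      _ ≤ _ := by gcongr
  · push_cast
    positivity

variable [DecidableEq V]

open Classical in
theorem inducedEdges_insert {a : V} {S : Finset V} (ha : a ∉ S) :
    inducedEdges G (insert a S) = inducedEdges G S + (S.filter (G.Adj a)).card := by
  unfold inducedEdges
  rw [Finset.sym2_insert, Finset.filter_union, Finset.card_union_of_disjoint, add_comm]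
  · congr 1
    rw [Finset.filter_image, Finset.card_image_of_injective _ fun x y h => Sym2.congr_right.1 h]
    congr 1
    ext b
    simp only [Finset.mem_filter, Finset.mem_insert, SimpleGraph.mem_edgeSet]
    constructor
    · rintro ⟨rfl | h, h'⟩
      · exact absurd h' (G.loopless.irrefl _)
      · exact ⟨h, h'⟩
    · exact fun h => ⟨Or.inr h.1, h.2⟩
  · rw [Finset.disjoint_left]
    intro e he he'
    obtain ⟨b, -, rfl⟩ := Finset.mem_image.1 (Finset.mem_filter.1 he).1
    exact ha (Finset.mk_mem_sym2_iff.1 (Finset.mem_filter.1 he').1).1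

-- The final `+ 1`, contributed by the edge `uv`, drives every later count over the four extensions
-- of `B` by `u` and `v`.
open Classical in
theorem inducedEdges_insert_insert {u v : V} {B : Finset V} (huv : G.Adj u v) (hu : u ∉ B)
    (hv : v ∉ B) : inducedEdges G (insert u (insert v B)) =
      inducedEdges G B + (B.filter (G.Adj u)).card + (B.filter (G.Adj v)).card + 1 := by
  rw [inducedEdges_insert (by simp [huv.ne, hu]), inducedEdges_insert hv, Finset.filter_insert,
    if_pos huv, Finset.card_insert_of_notMem (by simp [hv])]
  omega

/-- Vertices of `A` that have no neighbours in `A` do not contribute edges. -/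
theorem inducedEdges_inter {A W : Finset V}
    (h : ∀ u ∈ A, ∀ v ∈ A, G.Adj u v → u ∈ W) : inducedEdges G (A ∩ W) = inducedEdges G A := by
  unfold inducedEdges
  congr 1
  ext e
  induction e with | _ u v
  simp only [Finset.mem_filter, Finset.mk_mem_sym2_iff, SimpleGraph.mem_edgeSet, Finset.mem_inter]
  constructor
  · rintro ⟨⟨hu, hv⟩, h⟩
    exact ⟨⟨hu.1, hv.1⟩, h⟩
  · rintro ⟨⟨hu, hv⟩, h'⟩
    exact ⟨⟨⟨hu, h u hu v hv h'⟩, hv, h v hv u hu h'.symm⟩, h'⟩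

theorem inducedEdges_eq_zero {W : Finset V} (h : ∀ u ∈ W, ∀ v ∈ W, ¬ G.Adj u v) :
    inducedEdges G W = 0 := by
  rw [← inducedEdges_inter (W := ∅) fun u hu v hv huv => (h u hu v hv huv).elim]
  simp [inducedEdges]

theorem exists_eq_insert_insert {W : Finset V} {u v : V} (hu : u ∈ W) (hv : v ∈ W) (h : u ≠ v) :
    ∃ W' : Finset V, u ∉ W' ∧ v ∉ W' ∧ W = insert u (insert v W') := by
  refine ⟨(W.erase u).erase v, by simp, by simp, ?_⟩
  rw [Finset.insert_erase (Finset.mem_erase.2 ⟨h.symm, hv⟩), Finset.insert_erase hu]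

theorem sum_powerset_insert_insert {M : Type} [AddCommMonoid M] (f : Finset V → M) {W : Finset V}
    {u v : V} (hu : u ∉ W) (hv : v ∉ W) (h : u ≠ v) :
    ∑ S ∈ (insert u (insert v W)).powerset, f S =
      ∑ B ∈ W.powerset, (f B + f (insert v B) + f (insert u B) + f (insert u (insert v B))) := by
  rw [Finset.sum_powerset_insert (by simp [h, hu]), Finset.sum_powerset_insert hv,
    Finset.sum_powerset_insert hv]
  simp only [Finset.sum_add_distrib]
  abel

/-! ### Exact edge counts over all subsets of a fixed set -/

/-- At most three quarters of the subsets of `W` induce exactly `ℓ ≥ 1` edges. -/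
theorem four_mul_card_inducedEdges_eq_le (G : SimpleGraph V) {ℓ : ℕ} (hℓ : 1 ≤ ℓ) (W : Finset V) :
    4 * (W.powerset.filter (inducedEdges G · = ℓ)).card ≤ 3 * 2 ^ W.card := by
  classical
  by_cases hW : ∃ u ∈ W, ∃ v ∈ W, G.Adj u v
  · obtain ⟨u, hu, v, hv, huv⟩ := hW
    obtain ⟨W, hu', hv', rfl⟩ := exists_eq_insert_insert hu hv huv.ne
    clear hu hv
    rename' hu' => hu, hv' => hv
    rw [Finset.card_insert_of_notMem (by simp [hu, huv.ne]), Finset.card_insert_of_notMem hv,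
      Finset.card_filter, sum_powerset_insert_insert _ hu hv huv.ne]
    -- If `B`, `B + v` and `B + u` all induce `ℓ` edges, then `u` and `v` have no neighbours in `B`,
    -- so `B + u + v` induces `ℓ + 1`. Hence at most three of the four succeed.
    have := Finset.sum_le_card_nsmul W.powerset (fun B =>
      (if inducedEdges G B = ℓ then 1 else 0) + (if inducedEdges G (insert v B) = ℓ then 1 else 0) +
      (if inducedEdges G (insert u B) = ℓ then 1 else 0) +
      (if inducedEdges G (insert u (insert v B)) = ℓ then 1 else 0)) 3 fun B hB => by
        rw [Finset.mem_powerset] at hB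
        have hu' : u ∉ B := fun h => hu (hB h)
        have hv' : v ∉ B := fun h => hv (hB h)
        simp only [inducedEdges_insert_insert huv hu' hv', inducedEdges_insert hu',
          inducedEdges_insert hv']
        split_ifs <;> omega
    rw [Finset.card_powerset, smul_eq_mul] at this
    rw [pow_succ, pow_succ]
    omega
  · push Not at hW
    rw [Finset.filter_false_of_mem]
    · simp
    · intro S hS h
      have := inducedEdges_mono (G := G) (Finset.mem_powerset.1 hS)
      rw [inducedEdges_eq_zero hW] at this
      omega

/-- At most half of the subsets of `W` induce exactly one edge. -/
theorem two_mul_card_inducedEdges_eq_one_le (G : SimpleGraph V) (W : Finset V) :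
    2 * (W.powerset.filter (inducedEdges G · = 1)).card ≤ 2 ^ W.card := by
  classical
  induction W using Finset.strongInduction with | _ W ih
  by_cases hW : ∃ u ∈ W, ∃ v ∈ W, G.Adj u v
  · obtain ⟨u, hu, v, hv, huv⟩ := hW
    obtain ⟨W, hu', hv', rfl⟩ := exists_eq_insert_insert hu hv huv.ne
    clear hu hv
    rename' hu' => hu, hv' => hv
    rw [Finset.card_insert_of_notMem (by simp [hu, huv.ne]), Finset.card_insert_of_notMem hv,
      Finset.card_filter, sum_powerset_insert_insert _ hu hv huv.ne]
    -- For `B ⊆ Z` the four extensions have `e, e, e, e + 1` edges: three successes if `e = 1`, one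
    -- if `e = 0`, none otherwise. The induction hypothesis on `Z` says that the surplus from `e =
    -- 1` is paid for by the deficit elsewhere.
    set Z := W.filter (fun x => ¬ G.Adj u x ∧ ¬ G.Adj v x) with hZ
    have hZW : Z ⊆ W := Finset.filter_subset _ _
    have ihZ := ih Z (Finset.ssubset_of_subset_of_ssubset hZW
      ((Finset.ssubset_insert hv).trans_subset (Finset.subset_insert _ _)))
    have key : ∀ B ∈ W.powerset,
        (if inducedEdges G B = 1 then 1 else 0) +
        (if inducedEdges G (insert v B) = 1 then 1 else 0) +
        (if inducedEdges G (insert u B) = 1 then 1 else 0) +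
        (if inducedEdges G (insert u (insert v B)) = 1 then 1 else 0) + (if B ⊆ Z then 1 else 0) ≤
        2 + if B ⊆ Z then (if inducedEdges G B = 1 then 2 else 0) else 0 := by
      intro B hB
      rw [Finset.mem_powerset] at hB
      have hu' : u ∉ B := fun h => hu (hB h)
      have hv' : v ∉ B := fun h => hv (hB h)
      rw [inducedEdges_insert_insert huv hu' hv', inducedEdges_insert hu', inducedEdges_insert hv']
      by_cases hBZ : B ⊆ Z
      · have h1 : B.filter (G.Adj u) = ∅ := Finset.filter_false_of_mem fun x hx =>
          (Finset.mem_filter.1 (hBZ hx)).2.1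
        have h2 : B.filter (G.Adj v) = ∅ := Finset.filter_false_of_mem fun x hx =>
          (Finset.mem_filter.1 (hBZ hx)).2.2
        rw [h1, h2, Finset.card_empty, if_pos hBZ, if_pos hBZ]
        split_ifs <;> omega
      -- Now `B + u + v` has at least two edges, and the other three extensions do not all have the
      -- same number, so at most two succeed.
      · have h3 : 0 < (B.filter (G.Adj u)).card + (B.filter (G.Adj v)).card := by
          obtain ⟨x, hx, hxZ⟩ := Finset.not_subset.1 hBZ
          have : G.Adj u x ∨ G.Adj v x := by
            by_contra hcon
            rw [not_or] at hcon
            exact hxZ (Finset.mem_filter.2 ⟨hB hx, hcon⟩)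
          obtain h | h := this
          · have := Finset.card_pos.2 ⟨x, Finset.mem_filter.2 ⟨hx, h⟩⟩
            omega
          · have := Finset.card_pos.2 ⟨x, Finset.mem_filter.2 ⟨hx, h⟩⟩
            omega
        rw [if_neg hBZ, if_neg hBZ]
        split_ifs <;> omega
    have hsum := Finset.sum_le_sum key
    have hZsum (f : Finset V → ℕ) : ∑ B ∈ W.powerset, (if B ⊆ Z then f B else 0) =
        ∑ B ∈ Z.powerset, f B := by
      rw [← Finset.sum_filter]
      congr 1
      ext S
      simp only [Finset.mem_filter, Finset.mem_powerset]
      exact ⟨fun h => h.2, fun h => ⟨h.trans hZW, h⟩⟩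
    rw [Finset.sum_add_distrib, Finset.sum_add_distrib (f := fun _ => 2), hZsum, hZsum,
      ← Finset.sum_filter, Finset.sum_const, Finset.sum_const, Finset.sum_const,
      Finset.card_powerset, Finset.card_powerset] at hsum
    simp only [smul_eq_mul, mul_one] at hsum
    rw [pow_succ, pow_succ]
    omega
  · push Not at hW
    rw [Finset.filter_false_of_mem]
    · simp
    · intro S hS h
      have := inducedEdges_mono (G := G) (Finset.mem_powerset.1 hS)
      rw [inducedEdges_eq_zero hW] at this
      omega

/-! ### Matchings, covers and stars -/

/-- Either some set spanned by `r` disjoint edges has few sparse subsets, or there is a small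
vertex cover. -/
theorem exists_matching_or_cover (G : SimpleGraph V) (r : ℕ) :
    (∃ U : Finset V, U.card = 2 * r ∧
      ∑ S ∈ U.powerset, (1 / 2 : ℝ) ^ inducedEdges G S ≤ (7 / 2) ^ r) ∨
    ∃ U : Finset V, U.card ≤ 2 * r ∧ ∀ u v, G.Adj u v → u ∈ U ∨ v ∈ U := by
  classical
  induction r with
  | zero => exact Or.inl ⟨∅, by simp, by simp [inducedEdges]⟩
  | succ r ih =>
    obtain ⟨U, hU, hs⟩ | ⟨U, hU, hc⟩ := ih
    -- Greedy step: either `U` is already a cover, or an edge disjoint from `U` can be added to it.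
    · by_cases hc : ∀ u v, G.Adj u v → u ∈ U ∨ v ∈ U
      · exact Or.inr ⟨U, by omega, hc⟩
      · push Not at hc
        obtain ⟨u, v, huv, hu, hv⟩ := hc
        refine Or.inl ⟨insert u (insert v U), ?_, ?_⟩
        · rw [Finset.card_insert_of_notMem (by simp [hu, huv.ne]),
            Finset.card_insert_of_notMem hv]
          omega
        -- Of the four extensions of `B`, three have weight at most that of `B`, and the one
        -- containing both ends of the new edge at most half: `7/2 = 1 + 1 + 1 + 1/2`.
        · rw [sum_powerset_insert_insert _ hu hv huv.ne, pow_succ']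
          refine le_trans ?_ (mul_le_mul_of_nonneg_left hs (by norm_num))
          rw [Finset.mul_sum]
          refine Finset.sum_le_sum fun B hB => ?_
          rw [Finset.mem_powerset] at hB
          have hu' : u ∉ B := fun h => hu (hB h)
          have hv' : v ∉ B := fun h => hv (hB h)
          have hp : ∀ {m}, inducedEdges G B ≤ m →
              (1 / 2 : ℝ) ^ m ≤ (1 / 2) ^ inducedEdges G B := fun h =>
            pow_le_pow_of_le_one (by norm_num) (by norm_num) h
          have h1 := hp (inducedEdges_mono (G := G) (Finset.subset_insert v B))
          have h2 := hp (inducedEdges_mono (G := G) (Finset.subset_insert u B))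
          have h3 : (1 / 2 : ℝ) ^ inducedEdges G (insert u (insert v B)) ≤
              1 / 2 * (1 / 2) ^ inducedEdges G B := by
            rw [← pow_succ']
            refine pow_le_pow_of_le_one (by norm_num) (by norm_num) ?_
            rw [inducedEdges_insert_insert huv hu' hv']
            omega
          linarith
    · exact Or.inr ⟨U, by omega, hc⟩

/-- A large star has few sparse subsets containing its centre. -/
theorem card_inducedEdges_le_star (G : SimpleGraph V) (ℓ : ℕ) {u : V} {L : Finset V}
    (hL : ∀ x ∈ L, G.Adj u x) :
    (((insert u L).powerset.filter (inducedEdges G · ≤ ℓ)).card : ℝ) ≤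
      2 ^ L.card + 2 ^ ℓ * (3 / 2) ^ L.card := by
  classical
  have hu : u ∉ L := fun h => G.loopless.irrefl _ (hL u h)
  rw [Finset.card_filter, Finset.sum_powerset_insert hu, ← Finset.card_filter,
    ← Finset.card_filter, Nat.cast_add]
  refine add_le_add ?_ ?_
  · calc (_ : ℝ) ≤ (L.powerset.card : ℝ) := by
          exact_mod_cast Finset.card_filter_le _ _
      _ = _ := by rw [Finset.card_powerset]; norm_num
  -- With the centre present, `S ⊆ L` contributes at least `|S|` edges; the weights `2 ^ (-|S|)` sum
  -- to `(3/2) ^ |L|`.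
  · have h := Finset.sum_pow_mul_eq_add_pow (1 / 2 : ℝ) 1 L
    rw [show (1 / 2 + 1 : ℝ) = 3 / 2 by norm_num] at h
    rw [← h, Finset.card_filter, Nat.cast_sum, Finset.mul_sum]
    refine Finset.sum_le_sum fun S hS => ?_
    rw [Finset.mem_powerset] at hS
    rw [one_pow, mul_one]
    split_ifs with hle
    · rw [inducedEdges_insert fun h => hu (hS h),
        Finset.filter_true_of_mem fun x hx => hL x (hS hx)] at hle
      have : (1 / 2 : ℝ) ^ ℓ ≤ (1 / 2 : ℝ) ^ S.card :=
        pow_le_pow_of_le_one (by norm_num) (by norm_num) (by omega)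
      calc ((1 : ℕ) : ℝ) = 2 ^ ℓ * (1 / 2) ^ ℓ := by rw [← mul_pow]; norm_num
        _ ≤ _ := by gcongr
    · push_cast
      positivity

end InducedEdges

/-! ### Monotonicity in the order of the host graph -/

theorem edgeDensity_le_maxEdgeDensity {n : ℕ} (G : SimpleGraph (Fin n)) (k ℓ : ℕ) :
    edgeDensity G k ℓ ≤ maxEdgeDensity n k ℓ :=
  le_ciSup (f := fun G : SimpleGraph (Fin n) => edgeDensity G k ℓ)
    (Set.finite_range _).bddAbove G

/-- `I(n, k, ℓ)` is non-increasing in `n ≥ k`. -/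
theorem maxEdgeDensity_succ_le {n k : ℕ} (ℓ : ℕ) (hn : k ≤ n) :
    maxEdgeDensity (n + 1) k ℓ ≤ maxEdgeDensity n k ℓ := by
  refine ciSup_le fun G => ?_
  have hs : ∑ v : Fin (n + 1), edgeCount (G.comap v.succAboveEmb) k ℓ =
      (n + 1 - k) * edgeCount G k ℓ := by
    convert sum_count_delete (P := fun _ G => numEdges G = ℓ)
      (fun _ _ _ _ e => by rw [numEdges_congr e]) (k := k) G <;>
    simp only [edgeCount] <;> congr!
  have hs' : ∑ v : Fin (n + 1), (edgeCount (G.comap v.succAboveEmb) k ℓ : ℝ) =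
      ((n + 1 - k : ℕ) : ℝ) * (edgeCount G k ℓ : ℝ) := by
    exact_mod_cast hs
  have hpos : (0 : ℝ) < (n.choose k : ℝ) := by exact_mod_cast Nat.choose_pos hn
  have hpos' : (0 : ℝ) < ((n + 1).choose k : ℝ) := by
    exact_mod_cast Nat.choose_pos (by omega)
  have hd : (0 : ℝ) < ((n + 1 - k : ℕ) : ℝ) := by
    exact_mod_cast (by omega : 0 < n + 1 - k)
  have hb : ∑ v : Fin (n + 1), (edgeCount (G.comap v.succAboveEmb) k ℓ : ℝ) ≤
      ((n : ℝ) + 1) * (maxEdgeDensity n k ℓ * (n.choose k : ℝ)) := by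
    calc _ ≤ ∑ v : Fin (n + 1), maxEdgeDensity n k ℓ * (n.choose k : ℝ) :=
          Finset.sum_le_sum fun v _ => (div_le_iff₀ hpos).1 (edgeDensity_le_maxEdgeDensity _ _ _)
      _ = _ := by simp
  have hch : ((n + 1).choose k : ℝ) * ((n + 1 - k : ℕ) : ℝ) =
      (n.choose k : ℝ) * ((n : ℝ) + 1) := by
    exact_mod_cast (Nat.choose_mul_succ_eq n k).symm
  rw [edgeDensity, div_le_iff₀ hpos']
  refine le_of_mul_le_mul_left ?_ hd
  calc ((n + 1 - k : ℕ) : ℝ) * (edgeCount G k ℓ : ℝ)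
      ≤ ((n : ℝ) + 1) * (maxEdgeDensity n k ℓ * (n.choose k : ℝ)) := hs' ▸ hb
    _ = maxEdgeDensity n k ℓ * ((n.choose k : ℝ) * ((n : ℝ) + 1)) := by ring
    _ = _ := by rw [← hch]; ring

theorem edgeInducibility_le_maxEdgeDensity {n k : ℕ} (ℓ : ℕ) (hn : k ≤ n) :
    edgeInducibility k ℓ ≤ maxEdgeDensity n k ℓ := by
  refine le_of_tendsto (tendsto_maxEdgeDensity k ℓ) (eventually_atTop.2 ⟨n, fun m hm => ?_⟩)
  induction m, hm using Nat.le_induction with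
  | base => exact le_rfl
  | succ m hm ih => exact (maxEdgeDensity_succ_le ℓ (hn.trans hm)).trans ih

theorem graphInducibility_le_edgeInducibility {k : ℕ} (H : SimpleGraph (Fin k)) :
    graphInducibility H ≤ edgeInducibility k (numEdges H) := by
  classical
  refine le_of_tendsto_of_tendsto' (tendsto_maxCopyDensity H) (tendsto_maxEdgeDensity _ _)
    fun n => ciSup_le fun G => le_trans ?_ (edgeDensity_le_maxEdgeDensity G k _)
  refine div_le_div_of_nonneg_right (Nat.cast_le.2 (Finset.card_le_card fun A hA => ?_))
    (Nat.cast_nonneg _)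
  rw [Finset.mem_filter] at hA ⊢
  exact ⟨hA.1, numEdges_congr hA.2.some⟩

/-! ### Comparison with the central binomial coefficient -/

theorem factorial_le_factorial_mul_pow {a k : ℕ} (h : a ≤ k) :
    k.factorial ≤ a.factorial * k ^ (k - a) := by
  rw [← Nat.factorial_mul_descFactorial (Nat.sub_le k a), Nat.sub_sub_self h]
  exact Nat.mul_le_mul_left _ (Nat.descFactorial_le_pow _ _)

/-- Bounds the number of halves with a given trace: with `w = 2k - (a + b)`, the ratio of the two
binomials is at most `(k / (2k - w)) ^ w`, which is close to `2 ^ (-w)` for bounded `w`. -/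
theorem choose_mul_pow_le_centralBinom {a b k : ℕ} (ha : a ≤ k) (hb : b ≤ k) :
    (a + b).choose a * (a + b) ^ (2 * k - (a + b)) ≤
      (2 * k).choose k * k ^ (2 * k - (a + b)) := by
  have h1 := factorial_le_factorial_mul_pow ha
  have h2 := factorial_le_factorial_mul_pow hb
  have h3 := Nat.factorial_mul_pow_sub_le_factorial (show a + b ≤ 2 * k by omega)
  have h4 := Nat.choose_mul_factorial_mul_factorial (show a ≤ a + b by omega)
  have h5 := Nat.choose_mul_factorial_mul_factorial (show k ≤ 2 * k by omega)
  rw [show a + b - a = b by omega] at h4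
  rw [show 2 * k - k = k by omega] at h5
  rw [show k ^ (2 * k - (a + b)) = k ^ (k - a) * k ^ (k - b) by rw [← pow_add]; congr 1; omega]
  refine Nat.le_of_mul_le_mul_right ?_ (Nat.mul_pos k.factorial_pos k.factorial_pos)
  calc _ ≤ (a + b).choose a * (a + b) ^ (2 * k - (a + b)) *
        ((a.factorial * k ^ (k - a)) * (b.factorial * k ^ (k - b))) := by gcongr
    _ = ((a + b).choose a * a.factorial * b.factorial) * (a + b) ^ (2 * k - (a + b)) *
        (k ^ (k - a) * k ^ (k - b)) := by ring
    _ ≤ (2 * k).factorial * (k ^ (k - a) * k ^ (k - b)) := by rw [h4]; gcongr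
    _ = _ := by rw [← h5]; ring

/-! ### The trace of a random half on a bounded set -/

section Trace

variable {V : Type} [Fintype V] [DecidableEq V]

theorem card_inter_eq_le (k : ℕ) (W S : Finset V) :
    ((Finset.powersetCard k (Finset.univ : Finset V)).filter (· ∩ W = S)).card ≤
      (Fintype.card V - W.card).choose (k - S.card) := by
  rw [← Finset.card_compl, ← Finset.card_powersetCard]
  refine Finset.card_le_card_of_injOn (· \ W) ?_ ?_
  · intro A hA
    simp only [Finset.coe_filter, Finset.mem_powersetCard, Finset.subset_univ, true_and,
      Set.mem_ofPred_eq] at hA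
    simp only [Finset.mem_coe, Finset.mem_powersetCard]
    refine ⟨fun x hx => Finset.mem_compl.2 (Finset.mem_sdiff.1 hx).2, ?_⟩
    have := Finset.card_sdiff_add_card_inter A W
    rw [hA.2, hA.1] at this
    omega
  · intro A hA B hB h
    simp only [Finset.coe_filter, Set.mem_ofPred_eq] at hA hB
    change A \ W = B \ W at h
    rw [← Finset.sdiff_union_inter A W, ← Finset.sdiff_union_inter B W, h, hA.2, hB.2]

/-- The trace on a small set of a random half of the vertices is nearly uniform. -/
theorem card_inter_mem_mul_pow_le {k : ℕ} (hV : Fintype.card V = 2 * k) {W : Finset V}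
    (hW : W.card ≤ k) {𝒮 : Finset (Finset V)} (h𝒮 : 𝒮 ⊆ W.powerset) :
    ((Finset.powersetCard k (Finset.univ : Finset V)).filter (· ∩ W ∈ 𝒮)).card *
      (2 * k - W.card) ^ W.card ≤ 𝒮.card * ((2 * k).choose k * k ^ W.card) := by
  have hmaps : ((Finset.powersetCard k (Finset.univ : Finset V)).filter (· ∩ W ∈ 𝒮) :
      Set (Finset V)).MapsTo (· ∩ W) 𝒮 := fun A hA => (Finset.mem_filter.1 hA).2
  rw [Finset.card_eq_sum_card_fiberwise hmaps, Finset.sum_mul, ← smul_eq_mul]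
  refine Finset.sum_le_card_nsmul _ _ _ fun S hS => ?_
  have hSW := Finset.card_le_card (Finset.mem_powerset.1 (h𝒮 hS))
  have h1 : ((((Finset.powersetCard k (Finset.univ : Finset V)).filter
      (· ∩ W ∈ 𝒮)).filter (· ∩ W = S)).card ≤ (2 * k - W.card).choose (k - S.card)) := by
    rw [← hV]
    exact (Finset.card_le_card (Finset.filter_subset_filter _ (Finset.filter_subset _ _))).trans
      (card_inter_eq_le k W S)
  -- Outside `W`, a half with trace `S` has `a` vertices and its complement has `b`.
  have h2 := choose_mul_pow_le_centralBinom (a := k - S.card) (b := k - (W.card - S.card))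
    (k := k) (by omega) (by omega)
  rw [show k - S.card + (k - (W.card - S.card)) = 2 * k - W.card by omega,
    show 2 * k - (2 * k - W.card) = W.card by omega] at h2
  exact (Nat.mul_le_mul_right _ h1).trans h2

/-- Every graph has a bounded set of vertices whose intersection with any set inducing `ℓ` edges
is restricted to a proportion of at most about `c` of its subsets, where `c ≥ 1/2` bounds the
proportion of subsets of a fixed set inducing `ℓ` edges. -/
theorem exists_restricted_trace (G : SimpleGraph V) {ℓ r D : ℕ} {c : ℝ}
    (hc : ∀ W : Finset V, ((W.powerset.filter (inducedEdges G · = ℓ)).card : ℝ) ≤ c * 2 ^ W.card)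
    (hr : 2 ^ ℓ * (7 / 2 : ℝ) ^ r ≤ c * 4 ^ r)
    (hD : (2 : ℝ) ^ D + 2 ^ ℓ * (3 / 2) ^ D ≤ c * 2 ^ (D + 1)) :
    ∃ W : Finset V, W.card ≤ 2 * r * (D + 1) + (D + 1) ∧ ∃ 𝒮 ⊆ W.powerset,
      (∀ A, inducedEdges G A = ℓ → A ∩ W ∈ 𝒮) ∧ (𝒮.card : ℝ) ≤ c * 2 ^ W.card := by
  classical
  have hle (W : Finset V) : ∀ A, inducedEdges G A = ℓ →
      A ∩ W ∈ W.powerset.filter (inducedEdges G · ≤ ℓ) := fun A hA =>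
    Finset.mem_filter.2 ⟨Finset.mem_powerset.2 Finset.inter_subset_right,
      (inducedEdges_mono Finset.inter_subset_left).trans hA.le⟩
  by_cases hstar : ∃ u, D ≤ (Finset.univ.filter (G.Adj u)).card
  · obtain ⟨u, hu⟩ := hstar
    obtain ⟨L, hL, hLc⟩ := Finset.exists_subset_card_eq hu
    have hadj : ∀ x ∈ L, G.Adj u x := fun x hx => (Finset.mem_filter.1 (hL hx)).2
    have hcard : (insert u L).card = D + 1 := by
      rw [Finset.card_insert_of_notMem fun h => G.loopless.irrefl _ (hadj u h), hLc]
    refine ⟨insert u L, by omega, _, Finset.filter_subset _ _, hle _, ?_⟩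
    refine (card_inducedEdges_le_star G ℓ hadj).trans ?_
    rwa [hcard, hLc]
  · push Not at hstar
    obtain ⟨U, hU, hs⟩ | ⟨U, hU, hcov⟩ := exists_matching_or_cover G r
    · refine ⟨U, by nlinarith, _, Finset.filter_subset _ _, hle _, ?_⟩
      refine (card_inducedEdges_le_le G ℓ U).trans ?_
      rw [hU, pow_mul, show (2 : ℝ) ^ 2 = 4 by norm_num]
      exact le_trans (by gcongr) hr
    -- Every edge meets the cover `U`, so both its ends lie in `W`; hence passing to `A ∩ W` loses
    -- no edge.
    · set W := U ∪ U.biUnion fun u => Finset.univ.filter (G.Adj u) with hW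
      have hWc : W.card ≤ 2 * r * (D + 1) := by
        have h1 := Finset.card_union_le U (U.biUnion fun u => Finset.univ.filter (G.Adj u))
        have h2 := Finset.card_biUnion_le_card_mul U (fun u => Finset.univ.filter (G.Adj u)) D
          fun u _ => (hstar u).le
        calc _ ≤ U.card + U.card * D := h1.trans (by omega)
          _ = U.card * (D + 1) := by ring
          _ ≤ _ := Nat.mul_le_mul_right _ hU
      refine ⟨W, by omega, _, Finset.filter_subset _ _, fun A hA => ?_, hc W⟩
      refine Finset.mem_filter.2 ⟨Finset.mem_powerset.2 Finset.inter_subset_right, ?_⟩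
      rw [inducedEdges_inter, hA]
      intro u _ v _ huv
      obtain h | h := hcov u v huv
      · exact Finset.mem_union_left _ h
      · exact Finset.mem_union_right _ (Finset.mem_biUnion.2
          ⟨v, h, Finset.mem_filter.2 ⟨Finset.mem_univ _, huv.symm⟩⟩)

end Trace

/-! ### From subset proportions to edge-inducibility -/

theorem exists_two_pow_mul_pow_le (ℓ : ℕ) {q δ : ℝ} (hq : q < 1) (hδ : 0 < δ) :
    ∃ r : ℕ, 2 ^ ℓ * q ^ r ≤ δ := by
  have h : (0 : ℝ) < δ / 2 ^ ℓ := by positivity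
  obtain ⟨r, hr⟩ := exists_pow_lt_of_lt_one h hq
  exact ⟨r, by rw [lt_div_iff₀ (by positivity)] at hr; linarith⟩

/-- A bound for the proportion of subsets of a set inducing exactly `ℓ` edges is, asymptotically,
a bound for the edge-inducibility. -/
theorem edgeInducibility_le_of_cube {ℓ : ℕ} {c : ℝ} (hc2 : 1 / 2 ≤ c)
    (hc : ∀ (n : ℕ) (G : SimpleGraph (Fin n)) (W : Finset (Fin n)),
      ((W.powerset.filter (inducedEdges G · = ℓ)).card : ℝ) ≤ c * 2 ^ W.card)
    {ε : ℝ} (hε : 0 < ε) :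
    ∃ k₀ : ℕ, ∀ k : ℕ, k₀ ≤ k → edgeInducibility k ℓ ≤ c + ε := by
  -- The ratios are `7/8 = (7/2)/4` for each matching edge and `3/4 = (3/2)/2` for each leaf of the
  -- star. The star proportion tends only to `1/2`, hence the requirement `1/2 ≤ c`.
  obtain ⟨r, hr⟩ := exists_two_pow_mul_pow_le ℓ (q := 7 / 8) (by norm_num)
    (show (0 : ℝ) < c by linarith)
  obtain ⟨D, hD⟩ := exists_two_pow_mul_pow_le ℓ (q := 3 / 4) (by norm_num) hε
  have hr' : 2 ^ ℓ * (7 / 2 : ℝ) ^ r ≤ (c + ε / 2) * 4 ^ r := by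
    calc 2 ^ ℓ * (7 / 2 : ℝ) ^ r = 2 ^ ℓ * (7 / 8) ^ r * 4 ^ r := by
          rw [mul_assoc, ← mul_pow]; norm_num
      _ ≤ _ := by gcongr; linarith
  have hD' : (2 : ℝ) ^ D + 2 ^ ℓ * (3 / 2) ^ D ≤ (c + ε / 2) * 2 ^ (D + 1) := by
    calc (2 : ℝ) ^ D + 2 ^ ℓ * (3 / 2) ^ D = (1 + 2 ^ ℓ * (3 / 4) ^ D) * 2 ^ D := by
          rw [add_mul, mul_assoc, ← mul_pow]; norm_num
      _ ≤ (2 * (c + ε / 2)) * 2 ^ D := by gcongr; linarith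
      _ = _ := by ring
  set w₀ := 2 * r * (D + 1) + (D + 1) with hw₀
  -- Half of `ε` is spent on the restricted family; this bound on `k` lets the other half absorb the
  -- Bernoulli loss `w ^ 2 / (2k)`.
  obtain ⟨k₁, hk₁⟩ := exists_nat_ge ((c + ε) * w₀ ^ 2 / ε)
  refine ⟨max k₁ w₀, fun k hk => ?_⟩
  have hkw : w₀ ≤ k := (le_max_right _ _).trans hk
  have hkk : (c + ε) * w₀ ^ 2 ≤ k * ε := by
    rw [← div_le_iff₀ hε]
    exact hk₁.trans (by exact_mod_cast (le_max_left _ _).trans hk)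
  refine (edgeInducibility_le_maxEdgeDensity ℓ (show k ≤ 2 * k by omega)).trans
    (ciSup_le fun G => ?_)
  have hC : (0 : ℝ) < ((2 * k).choose k : ℝ) := by
    exact_mod_cast Nat.choose_pos (show k ≤ 2 * k by omega)
  rw [edgeDensity, div_le_iff₀ hC]
  obtain ⟨W, hW, 𝒮, h𝒮, hA, hcard⟩ := exists_restricted_trace G (c := c + ε / 2)
    (fun W => (hc _ G W).trans (by gcongr; linarith)) hr' hD'
  have hN : edgeCount G k ℓ ≤
      ((Finset.powersetCard k (Finset.univ : Finset (Fin (2 * k)))).filter (· ∩ W ∈ 𝒮)).card := by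
    refine Finset.card_le_card fun A h => ?_
    rw [Finset.mem_filter, numEdges_induce] at h
    exact Finset.mem_filter.2 ⟨h.1, hA A h.2⟩
  have hmul := (Nat.mul_le_mul_right _ hN).trans
    (card_inter_mem_mul_pow_le (Fintype.card_fin _) (hW.trans hkw) h𝒮)
  set w := W.card with hw
  have hk0 : (0 : ℝ) < k := by
    have : 0 < k := by omega
    exact_mod_cast this
  have hwk : (w : ℝ) ≤ k := by exact_mod_cast hW.trans hkw
  have hww : (w : ℝ) ≤ w₀ := by exact_mod_cast hW
  have hmul' : (edgeCount G k ℓ : ℝ) * (2 * k - w) ^ w ≤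
      𝒮.card * ((2 * k).choose k * (k : ℝ) ^ w) := by
    have hsub : ((2 * k - w : ℕ) : ℝ) = 2 * k - w := by
      rw [Nat.cast_sub (by omega)]
      push_cast
      rfl
    rw [← hsub]
    exact_mod_cast hmul
  have hbern : (1 - (w : ℝ) ^ 2 / (2 * k)) * (2 * k) ^ w ≤ (2 * k - w) ^ w := by
    have h := one_add_mul_le_pow (a := -(w : ℝ) / (2 * k))
      (by rw [le_div_iff₀ (by positivity)]; linarith) w
    calc (1 - (w : ℝ) ^ 2 / (2 * k)) * (2 * k) ^ w
        = (1 + w * (-(w : ℝ) / (2 * k))) * (2 * k) ^ w := by ring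
      _ ≤ (1 + -(w : ℝ) / (2 * k)) ^ w * (2 * k) ^ w := by gcongr
      _ = _ := by rw [← mul_pow]; congr 1; field_simp; ring
  have hce : c + ε / 2 ≤ (c + ε) * (1 - (w : ℝ) ^ 2 / (2 * k)) := by
    have h1 : (c + ε) * (w : ℝ) ^ 2 ≤ k * ε := le_trans (by gcongr) hkk
    have h2 : (c + ε) * ((w : ℝ) ^ 2 / (2 * k)) ≤ ε / 2 := by
      rw [← mul_div_assoc, div_le_iff₀ (by positivity)]
      linarith
    linarith
  refine le_of_mul_le_mul_right ?_ (pow_pos (show (0 : ℝ) < 2 * k - w by linarith) w)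
  calc _ ≤ (𝒮.card : ℝ) * ((2 * k).choose k * (k : ℝ) ^ w) := hmul'
    _ ≤ ((c + ε / 2) * 2 ^ w) * ((2 * k).choose k * (k : ℝ) ^ w) := by gcongr
    _ = (2 * k).choose k * ((c + ε / 2) * (2 * k) ^ w) := by rw [mul_pow]; ring
    _ ≤ (2 * k).choose k * (((c + ε) * (1 - (w : ℝ) ^ 2 / (2 * k))) * (2 * k) ^ w) := by gcongr
    _ = (2 * k).choose k * ((c + ε) * ((1 - (w : ℝ) ^ 2 / (2 * k)) * (2 * k) ^ w)) := by ring
    _ ≤ (2 * k).choose k * ((c + ε) * (2 * k - w) ^ w) := by gcongr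
    _ = _ := by ring

theorem edgeInducibility_le_three_quarters {ℓ : ℕ} (hℓ : 1 ≤ ℓ) {ε : ℝ} (hε : 0 < ε) :
    ∃ k₀ : ℕ, ∀ k : ℕ, k₀ ≤ k → edgeInducibility k ℓ ≤ 3 / 4 + ε := by
  refine edgeInducibility_le_of_cube (by norm_num) (fun n G W => ?_) hε
  have h : (4 : ℝ) * (W.powerset.filter (inducedEdges G · = ℓ)).card ≤ 3 * 2 ^ W.card := by
    exact_mod_cast four_mul_card_inducedEdges_eq_le G hℓ W
  linarith

theorem edgeInducibility_one_le_half {ε : ℝ} (hε : 0 < ε) :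
    ∃ k₀ : ℕ, ∀ k : ℕ, k₀ ≤ k → edgeInducibility k 1 ≤ 1 / 2 + ε := by
  refine edgeInducibility_le_of_cube le_rfl (fun n G W => ?_) hε
  have h : (2 : ℝ) * (W.powerset.filter (inducedEdges G · = 1)).card ≤ 2 ^ W.card := by
    exact_mod_cast two_mul_card_inducedEdges_eq_one_le G W
  linarith

end EdgeStat

theorem mainTheorem4 :
    (∀ ℓ : ℕ, 1 ≤ ℓ → ∀ ε : ℝ, 0 < ε → ∃ k₀ : ℕ, ∀ k : ℕ, k₀ ≤ k →
      EdgeStat.edgeInducibility k ℓ ≤ 3 / 4 + ε) ∧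
    (∀ ε : ℝ, 0 < ε → ∃ k₀ : ℕ, ∀ k : ℕ, k₀ ≤ k →
      EdgeStat.edgeInducibility k 1 ≤ 1 / 2 + ε) ∧
    (∀ ε : ℝ, 0 < ε → ∃ k₀ : ℕ, ∀ k : ℕ, k₀ ≤ k → ∀ H : SimpleGraph (Fin k),
      EdgeStat.numEdges H = 1 → EdgeStat.graphInducibility H ≤ 1 / 2 + ε) := by
  refine ⟨fun ℓ hℓ ε hε => EdgeStat.edgeInducibility_le_three_quarters hℓ hε,
    fun ε hε => EdgeStat.edgeInducibility_one_le_half hε, fun ε hε => ?_⟩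
  obtain ⟨k₀, hk₀⟩ := EdgeStat.edgeInducibility_one_le_half hε
  refine ⟨k₀, fun k hk H hH => ?_⟩
  have h := EdgeStat.graphInducibility_le_edgeInducibility H
  rw [hH] at h
  exact h.trans (hk₀ k hk)
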